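/- Let $d\ge 1$ and $k\ge 0$ be integers. Let $H:[0,1]\to[0,1]^d$ be a Hilbert curve with $H(0)=\mathbf 0$, that is, the limit of the approximations $H_m$ given by an enumeration, for every $m\ge 0$, of the $2^{md}$ closed dyadic subcubes of $[0,1]^d$ of side $2^{-m}$ as $S_m(0),\dots,S_m(2^{md}-1)$, such that $\mathbf 0\in S_m(0)$, consecutive cubes are adjacent, i.e. have at least one edge in common (an endpoint if $d=1$), and $S_{m+1}(2^dj),\dots,S_{m+1}(2^dj+2^d-1)$ are the $2^d$ dyadic subcubes of $S_m(j)$ for every $j$. Here $H_m(x)$ is the lower corner of the cube $S_m(j)$ with $x\in[j2^{-md},(j+1)2^{-md})$ (with $j=2^{md}-1$ for $x=1$). (For $d=1$, $H$ is the identity.) Let $h:[0,1]^d\to[0,1]$ be a pseudo-inverse of $H$, i.e. $H(h(\mathbf x))=\mathbf x$ for all $\mathbf x\in[0,1]^d$, and put $$H_k(x_0,\dots,x_k)=(H(x_0),\dots,H(x_k)),\qquad h_k(\mathbf x_0,\dots,\mathbf x_k)=(h(\mathbf x_0),\dots,h(\mathbf x_k))$$ for $x_i\in[0,1]$ and $\mathbf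 x_i\in[0,1]^d$. For probability measures $\mu,\nu$ on $\mathbb R^n$ define the extreme norm $$\|\mu-\nu\|_{\mathrm E}=\sup_B|\mu(B)-\nu(B)|,$$ where $B$ ranges over the boxes $\prod_{i=1}^n[a_i,b_i]$ with $0\le a_i<b_i<1$. Let $\pi(\mathrm d\mathbf x)=\pi(\mathbf x)\,\lambda_{d(k+1)}(\mathrm d\mathbf x)$ be a probability measure on $[0,1)^{d(k+1)}$ with bounded density, let $\pi_{h_k}$ be the image of $\pi$ by $h_k$, and let $(\pi_{h_k}^N)_N$ be a sequence of probability measures on $[0,1)^{k+1}$ such that $\|\pi_{h_k}^N-\pi_{h_k}\|_{\mathrm E}\to 0$ as $N\to\infty$. Let $\pi^N$ be the image of $\pi_{h_k}^N$ by $H_k$ (a probability measure on $[0,1]^{d(k+1)}$). Then $$\|\pi^N-\pi\|_{\mathrm E}\to 0\qquad\text{as } N\to\infty .$$ -/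

import Mathlib

open MeasureTheory Filter Topology
open scoped NNReal ENNReal

/-- Two cells `c`, `c'` of the dyadic grid of side `2^(-m)` in `[0,1]^d`, given by their integer
coordinates (the cell `c` is the closed cube `∏ i, [c i / 2^m, (c i + 1) / 2^m]`), are adjacent
if the closed cubes have at least one edge in common.  The intersection of the two cubes is empty
unless all coordinates differ by at most `1`, and is then a common face, of dimension
`#{i | c i = c' i}`.  For `d = 1` adjacent means that the two intervals share an endpoint. -/
def CellsAdjacent {d : ℕ} (c c' : Fin d → ℕ) : Prop :=
  (∀ i, c i ≤ c' i + 1 ∧ c' i ≤ c i + 1) ∧ (2 ≤ d → ∃ i, c i = c' i)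

/-- The combinatorial data of a Hilbert curve `H : [0,1] → [0,1]^d` with `H 0 = 0`: for every
level `m`, an enumeration `cell m 0, cell m 1, …, cell m (2^(d*m) - 1)` of the `2^(d*m)` closed
dyadic cubes of side `2^(-m)`; `cell m k` is the cube that the curve fills during the time
interval `[k / 2^(d*m), (k+1) / 2^(d*m)]`. -/
structure HilbertOrder (d : ℕ) where
  /-- integer coordinates of the `k`-th cube of level `m` (relevant only for `k < 2^(d*m)`) -/
  cell : ℕ → ℕ → Fin d → ℕ
  /-- every cube of level `m` is enumerated exactly once -/
  bijOn : ∀ m, Set.BijOn (cell m) (Set.Iio (2 ^ (d * m))) {c | ∀ i, c i < 2 ^ m}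
  /-- adjacency property: consecutive cubes are adjacent -/
  adjacent : ∀ m k, k + 1 < 2 ^ (d * m) → CellsAdjacent (cell m k) (cell m (k + 1))
  /-- nesting property: the cubes number `2^d * k, …, 2^d * k + 2^d - 1` of level `m + 1` are
  the dyadic subcubes of the cube number `k` of level `m` -/
  nested : ∀ m k, k < 2 ^ (d * (m + 1)) → ∀ i, cell (m + 1) k i / 2 = cell m (k / 2 ^ d) i
  /-- the curve starts at the origin -/
  start : ∀ m i, cell m 0 i = 0

namespace HilbertOrder

variable {d : ℕ}

/-- The number `k < 2^(d*m)` of a time interval `[k / 2^(d*m), (k+1) / 2^(d*m)]` that contains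
`x ∈ [0,1]`. -/
noncomputable def index (d m : ℕ) (x : ℝ) : ℕ :=
  min ⌊(2 : ℝ) ^ (d * m) * x⌋₊ (2 ^ (d * m) - 1)

/-- The `m`-th approximation `H_m` of the Hilbert curve: it sends `x ∈ [0,1]` to the lower corner
of the cube of level `m` that is visited at time `x`. -/
noncomputable def approx (O : HilbertOrder d) (m : ℕ) (x : ℝ) : Fin d → ℝ :=
  fun i => (O.cell m (index d m x) i : ℝ) / 2 ^ m

/-- The Hilbert curve `H = lim H_m` (only its values on `[0,1]` matter). -/
noncomputable def curve (O : HilbertOrder d) (x : ℝ) : Fin d → ℝ :=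
  limUnder atTop (fun m => O.approx m x)

theorem index_lt (d m : ℕ) (x : ℝ) : index d m x < 2 ^ (d * m) := by
  have : 0 < 2 ^ (d * m) := by positivity
  unfold index
  omega

theorem index_succ_div (d m : ℕ) (x : ℝ) : index d (m + 1) x / 2 ^ d = index d m x := by
  have h1 : ⌊(2 : ℝ) ^ (d * (m + 1)) * x⌋₊ / 2 ^ d = ⌊(2 : ℝ) ^ (d * m) * x⌋₊ := by
    have h := Nat.floor_div_natCast ((2 : ℝ) ^ (d * (m + 1)) * x) (2 ^ d)
    rw [← h]
    congr 1
    push_cast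
    rw [Nat.mul_succ, pow_add]
    field_simp
  have hpos : 0 < 2 ^ d := by positivity
  have h2 : (2 ^ (d * (m + 1)) - 1) / 2 ^ d = 2 ^ (d * m) - 1 := by
    have hp : 0 < 2 ^ (d * m) := by positivity
    rw [Nat.mul_succ, pow_add]
    obtain ⟨a, ha⟩ : ∃ a, 2 ^ (d * m) = a + 1 := ⟨2 ^ (d * m) - 1, by omega⟩
    rw [ha]
    have : (a + 1) * 2 ^ d - 1 = (2 ^ d - 1) + 2 ^ d * a := by
      rw [add_mul, mul_comm]; omega
    rw [this, Nat.add_mul_div_left _ _ hpos, Nat.div_eq_of_lt (by omega)]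
    omega
  unfold index
  have hmono : Monotone (fun n : ℕ => n / 2 ^ d) := fun a b hab => Nat.div_le_div_right hab
  have h3 := hmono.map_min (a := ⌊(2 : ℝ) ^ (d * (m + 1)) * x⌋₊) (b := 2 ^ (d * (m + 1)) - 1)
  rw [h3, h1, h2]

/-- The limit that defines the Hilbert curve exists. -/
theorem tendsto_approx (O : HilbertOrder d) (x : ℝ) :
    Tendsto (fun m => O.approx m x) atTop (𝓝 (O.curve x)) := by
  apply tendsto_nhds_limUnder
  have key : ∀ i, ∃ l, Tendsto (fun m => O.approx m x i) atTop (𝓝 l) := by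
    intro i
    refine ⟨_, tendsto_atTop_ciSup (f := fun m => O.approx m x i) (monotone_nat_of_le_succ ?_)
      ⟨1, ?_⟩⟩
    · intro m
      have h := O.nested m _ (index_lt d (m + 1) x) i
      rw [index_succ_div] at h
      have h' : 2 * O.cell m (index d m x) i ≤ O.cell (m + 1) (index d (m + 1) x) i := by omega
      have h'' : (2 : ℝ) * O.cell m (index d m x) i ≤ O.cell (m + 1) (index d (m + 1) x) i := by
        exact_mod_cast h'
      simp only [approx]
      rw [div_le_div_iff₀ (by positivity) (by positivity), pow_succ]
      nlinarith [pow_pos (two_pos : (0 : ℝ) < 2) m]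
    · rintro _ ⟨m, rfl⟩
      have h : O.cell m (index d m x) i < 2 ^ m := (O.bijOn m).mapsTo (index_lt d m x) i
      have h' : (O.cell m (index d m x) i : ℝ) ≤ 2 ^ m := by exact_mod_cast h.le
      simp only [approx]
      rw [div_le_one (by positivity)]
      exact h'
  choose l hl using key
  exact ⟨l, tendsto_pi_nhds.2 hl⟩

end HilbertOrder

/-- `h` is a pseudo-inverse of `H : [0,1] → [0,1]^d`: it maps `[0,1]^d` to `[0,1]` and
`H (h x) = x` for all `x ∈ [0,1]^d`. -/
def IsPseudoInverse {d : ℕ} (H : ℝ → Fin d → ℝ) (h : (Fin d → ℝ) → ℝ) : Prop :=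
  ∀ x ∈ Set.Icc (0 : Fin d → ℝ) 1, h x ∈ Set.Icc (0 : ℝ) 1 ∧ H (h x) = x

/-- `H_k (x_0, …, x_k) = (H x_0, …, H x_k)`; a point of `ℝ^(d(k+1))` is given by its `k + 1`
blocks of `d` coordinates. -/
def prodCurve {d : ℕ} (k : ℕ) (H : ℝ → Fin d → ℝ) (x : Fin (k + 1) → ℝ) :
    Fin (k + 1) × Fin d → ℝ :=
  fun p => H (x p.1) p.2

/-- `h_k (x_0, …, x_k) = (h x_0, …, h x_k)`, where `x_0, …, x_k` are the blocks of `d`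
coordinates of a point of `ℝ^(d(k+1))`. -/
def prodPseudoInverse {d : ℕ} (k : ℕ) (h : (Fin d → ℝ) → ℝ) (x : Fin (k + 1) × Fin d → ℝ) :
    Fin (k + 1) → ℝ :=
  fun i => h (fun j => x (i, j))

/-- The half-open unit cube `[0,1)^ι`. -/
def unitCube (ι : Type*) : Set (ι → ℝ) := {x | ∀ i, 0 ≤ x i ∧ x i < 1}

/-- The boxes `∏ i, [a i, b i]` with `0 ≤ a i < b i < 1`. -/
def extremeBoxes (ι : Type*) : Set (Set (ι → ℝ)) :=
  {B | ∃ a b : ι → ℝ, (∀ i, 0 ≤ a i ∧ a i < b i ∧ b i < 1) ∧ B = Set.Icc a b}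

/-- The extreme norm of `μ - ν`: the supremum of `|μ B - ν B|` over the boxes `B`. -/
noncomputable def extremeNorm {ι : Type*} (μ ν : Measure (ι → ℝ)) : ℝ :=
  sSup ((fun B => |μ.real B - ν.real B|) '' extremeBoxes ι)

/-! ### Dyadic cubes along the curve, and measurability -/

namespace HilbertOrder

variable {d : ℕ}

/-! Fix a level `m`. The curve at a given time lies in the cube indexed by that time, so the
preimage of a box under `prodCurve` is squeezed between two unions of products of time intervals:
those whose cube lies inside the box, and those whose cube meets it. Each union has at most
`2^(d*m*(k+1))` cells, so its masses under the two time-side measures differ by at most that number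
times their extreme norm (`abs_measureReal_index_preimage_sub_le`). Under `π` the two unions differ
only near the faces of the box, in slabs of mass `O(2^(-m))` because the density is bounded
(`withDensity_real_slab_le`). `abs_map_prodCurve_sub_le` combines both errors, uniformly in the box;
then `N → ∞` followed by `m → ∞`. -/

/-- The curve at time `x` lies in the closed dyadic cube visited at time `x`. -/
theorem cell_le_curve (O : HilbertOrder d) (m : ℕ) (x : ℝ) (i : Fin d) :
    (O.cell m (index d m x) i : ℝ) ≤ 2 ^ m * O.curve x i := by
  have hm : Monotone (fun m => O.approx m x i) := by
    refine monotone_nat_of_le_succ fun m => ?_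
    have h := O.nested m _ (index_lt d (m + 1) x) i
    rw [index_succ_div] at h
    have h'' : (2 : ℝ) * O.cell m (index d m x) i ≤ O.cell (m + 1) (index d (m + 1) x) i := by
      exact_mod_cast (by omega)
    simp only [approx]
    rw [div_le_div_iff₀ (by positivity) (by positivity), pow_succ]
    nlinarith [pow_pos (two_pos : (0 : ℝ) < 2) m]
  have := hm.ge_of_tendsto (tendsto_pi_nhds.1 (O.tendsto_approx x) i) m
  simp only [approx] at this
  rwa [div_le_iff₀' (by positivity)] at this

/-- The upper corners of the nested cubes decrease, to the same limit as the lower corners. -/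
theorem curve_le_cell_add_one (O : HilbertOrder d) (m : ℕ) (x : ℝ) (i : Fin d) :
    2 ^ m * O.curve x i ≤ (O.cell m (index d m x) i : ℝ) + 1 := by
  have hm : Antitone (fun m => O.approx m x i + (1 / 2 : ℝ) ^ m) := by
    refine antitone_nat_of_succ_le fun m => ?_
    have h := O.nested m _ (index_lt d (m + 1) x) i
    rw [index_succ_div] at h
    have h'' : (O.cell (m + 1) (index d (m + 1) x) i : ℝ) ≤ 2 * O.cell m (index d m x) i + 1 := by
      exact_mod_cast (by omega)
    simp only [approx, one_div, inv_pow]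
    rw [← one_div, ← one_div, ← add_div, ← add_div,
      div_le_div_iff₀ (by positivity) (by positivity), pow_succ]
    nlinarith [pow_pos (two_pos : (0 : ℝ) < 2) m]
  have ht : Tendsto (fun m => O.approx m x i + (1 / 2 : ℝ) ^ m) atTop (𝓝 (O.curve x i)) := by
    simpa using (tendsto_pi_nhds.1 (O.tendsto_approx x) i).add
      (tendsto_pow_atTop_nhds_zero_of_lt_one (by norm_num) (by norm_num : (1 / 2 : ℝ) < 1))
  have := hm.le_of_tendsto ht m
  simp only [approx, one_div, inv_pow] at this
  rwa [← one_div, ← add_div, le_div_iff₀' (by positivity)] at this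

theorem measurable_index (d m : ℕ) : Measurable (index d m) :=
  (Nat.measurable_floor.comp (measurable_const.mul measurable_id)).min measurable_const

theorem measurable_curve (O : HilbertOrder d) : Measurable O.curve := by
  refine measurable_of_tendsto_metrizable (f := fun m => O.approx m) (fun m => ?_)
    (tendsto_pi_nhds.2 O.tendsto_approx)
  refine measurable_pi_lambda _ fun i => ?_
  exact ((measurable_from_top (f := fun n : ℕ => (O.cell m n i : ℝ))).comp
    (measurable_index d m)).div_const _

/-- For `x < 1` the truncation in `index` is inactive. -/
theorem index_eq_iff {m n : ℕ} {x : ℝ} (hx : 0 ≤ x) (hx1 : x < 1) :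
    index d m x = n ↔ x ∈ Set.Ico ((n : ℝ) / 2 ^ (d * m)) ((n + 1 : ℝ) / 2 ^ (d * m)) := by
  have hp : (0 : ℝ) < 2 ^ (d * m) := by positivity
  have h0 : (0 : ℝ) ≤ 2 ^ (d * m) * x := by positivity
  have h1 : ⌊(2 : ℝ) ^ (d * m) * x⌋₊ < 2 ^ (d * m) := by
    rw [Nat.floor_lt h0]
    push_cast
    nlinarith
  have h2 : index d m x = ⌊(2 : ℝ) ^ (d * m) * x⌋₊ := by
    unfold index
    omega
  rw [h2, Nat.floor_eq_iff h0, Set.mem_Ico, div_le_iff₀' hp, lt_div_iff₀' hp]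

theorem tendsto_index_div (hd : 1 ≤ d) {x : ℝ} (hx : 0 ≤ x) (hx1 : x < 1) :
    Tendsto (fun m => (index d m x : ℝ) / 2 ^ (d * m)) atTop (𝓝 x) := by
  have hz : Tendsto (fun m : ℕ => x - ((1 / 2 : ℝ) ^ d) ^ m) atTop (𝓝 x) := by
    simpa using tendsto_const_nhds.sub (tendsto_pow_atTop_nhds_zero_of_lt_one
      (r := (1 / 2 : ℝ) ^ d) (by positivity) (pow_lt_one₀ (by norm_num) (by norm_num) (by omega)))
  refine tendsto_of_tendsto_of_tendsto_of_le_of_le hz tendsto_const_nhds (fun m => ?_) fun m => ?_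
  · have := ((index_eq_iff (d := d) (m := m) hx hx1).1 rfl).2
    rw [add_div] at this
    simp only [← pow_mul, one_div, inv_pow]
    rw [← one_div]
    linarith
  · exact ((index_eq_iff (d := d) (m := m) hx hx1).1 rfl).1

/-- A pseudo-inverse of a Hilbert curve is a.e. measurable along any measurable map that avoids
the dyadic hyperplanes and the end point of the curve almost everywhere. -/
theorem aemeasurable_pseudoInverse_comp (O : HilbertOrder d) (hd : 1 ≤ d)
    {h : (Fin d → ℝ) → ℝ} {Ω : Type*} [MeasurableSpace Ω]
    {μ : Measure Ω} {g : Ω → Fin d → ℝ} (hg : Measurable g)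
    (hgh : ∀ᵐ ω ∂μ, 0 ≤ h (g ω) ∧ h (g ω) < 1 ∧ O.curve (h (g ω)) = g ω)
    (hdy : ∀ᵐ ω ∂μ, ∀ (i : Fin d) (m n : ℕ), 2 ^ m * g ω i ≠ n) :
    AEMeasurable (fun ω => h (g ω)) μ := by
  -- Off the dyadic hyperplanes a point lies in a single cube of level `m`, given by floors. `J m`
  -- recovers its number, which must be the index of the time `h (g ω)`, however `h` was chosen.
  let J : ℕ → (Fin d → ℕ) → ℕ := fun m => Function.invFunOn (O.cell m) (Set.Iio (2 ^ (d * m)))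
  refine aemeasurable_of_tendsto_metrizable_ae atTop
    (f := fun m ω => (J m (fun i => ⌊(2 : ℝ) ^ m * g ω i⌋₊) : ℝ) / 2 ^ (d * m)) (fun m => ?_) ?_
  · have h1 : Measurable fun ω => fun i => ⌊(2 : ℝ) ^ m * g ω i⌋₊ :=
      measurable_pi_lambda _ fun i => Nat.measurable_floor.comp
        (measurable_const.mul ((measurable_pi_apply i).comp hg))
    exact (((measurable_of_countable fun c : Fin d → ℕ => (J m c : ℝ)).comp h1).div_const
      _).aemeasurable
  · filter_upwards [hgh, hdy] with ω h1 h2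
    obtain ⟨h0, h1, hc⟩ := h1
    convert tendsto_index_div hd h0 h1 using 4 with m
    have : (fun i => ⌊(2 : ℝ) ^ m * g ω i⌋₊) = O.cell m (index d m (h (g ω))) := by
      funext i
      have ha := O.cell_le_curve m (h (g ω)) i
      have hb := O.curve_le_cell_add_one m (h (g ω)) i
      rw [hc] at ha hb
      rw [Nat.floor_eq_iff (ha.trans' (Nat.cast_nonneg _))]
      refine ⟨ha, lt_of_le_of_ne hb ?_⟩
      exact_mod_cast h2 i m _
    rw [this]
    exact (O.bijOn m).injOn.leftInvOn_invFunOn (index_lt d m _)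

end HilbertOrder

/-! ### The extreme norm on half-open boxes and unions of grid cells -/

theorem extremeNorm_nonneg {ι : Type*} (μ ν : Measure (ι → ℝ)) : 0 ≤ extremeNorm μ ν := by
  refine Real.sSup_nonneg ?_
  rintro _ ⟨B, -, rfl⟩
  exact abs_nonneg _

theorem measurableSet_unitCube (ι : Type*) [Countable ι] : MeasurableSet (unitCube ι) := by
  simp only [unitCube, Set.ofPred_forall]
  exact MeasurableSet.iInter fun p => (measurableSet_le measurable_const
    (measurable_pi_apply p)).inter (measurableSet_lt (measurable_pi_apply p) measurable_const)

section ExtremeNorm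

variable {ι : Type*} (μ ν : Measure (ι → ℝ)) [IsProbabilityMeasure μ] [IsProbabilityMeasure ν]

theorem abs_measureReal_sub_le_extremeNorm {B : Set (ι → ℝ)} (hB : B ∈ extremeBoxes ι) :
    |μ.real B - ν.real B| ≤ extremeNorm μ ν := by
  refine le_csSup ⟨1, ?_⟩ ⟨B, hB, rfl⟩
  rintro _ ⟨B, -, rfl⟩
  rw [abs_le]
  constructor <;>
  linarith [measureReal_nonneg (μ := μ) (s := B), measureReal_nonneg (μ := ν) (s := B),
    measureReal_le_one (μ := μ) (s := B), measureReal_le_one (μ := ν) (s := B)]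

theorem abs_measureReal_pi_Ico_sub_le_extremeNorm [Finite ι] {a b : ι → ℝ}
    (hab : ∀ i, 0 ≤ a i ∧ a i < b i ∧ b i ≤ 1) :
    |μ.real (Set.univ.pi fun i => Set.Ico (a i) (b i)) -
      ν.real (Set.univ.pi fun i => Set.Ico (a i) (b i))| ≤ extremeNorm μ ν := by
  -- The exponent `n + 1` keeps `a i < c n i` already for `n = 0`; also `c n i < 1` even if `b i =
  -- 1`, so these closed boxes are admissible.
  set c : ℕ → ι → ℝ := fun n i => b i - (b i - a i) * (1 / 2) ^ (n + 1) with hc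
  have hmono : Monotone fun n => Set.Icc a (c n) := by
    intro m n hmn
    refine Set.Icc_subset_Icc_right fun i => ?_
    simp only [hc]
    have : (1 / 2 : ℝ) ^ (n + 1) ≤ (1 / 2) ^ (m + 1) :=
      pow_le_pow_of_le_one (by norm_num) (by norm_num) (by omega)
    have := mul_le_mul_of_nonneg_left this (sub_nonneg.2 (hab i).2.1.le)
    linarith
  have hU : ⋃ n, Set.Icc a (c n) = Set.univ.pi fun i => Set.Ico (a i) (b i) := by
    ext x
    simp only [Set.mem_iUnion, Set.mem_Icc, Set.mem_pi, Set.mem_univ, true_imp_iff, Set.mem_Ico]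
    constructor
    · rintro ⟨n, h1, h2⟩ i
      refine ⟨h1 i, (h2 i).trans_lt ?_⟩
      have : 0 < (b i - a i) * (1 / 2 : ℝ) ^ (n + 1) :=
        mul_pos (sub_pos.2 (hab i).2.1) (by positivity)
      simp only [hc]
      linarith
    · intro hx
      have : ∀ᶠ n in atTop, ∀ i, x i < c n i := by
        rw [eventually_all]
        intro i
        have ht : Tendsto (fun n => c n i) atTop (𝓝 (b i)) := by
          have := ((tendsto_pow_atTop_nhds_zero_of_lt_one (r := (1 / 2 : ℝ)) (by norm_num)
            (by norm_num)).comp (tendsto_add_atTop_nat 1)).const_mul (b i - a i)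
          simpa [hc] using tendsto_const_nhds.sub this
        exact ht.eventually_const_lt (hx i).2
      obtain ⟨n, hn⟩ := this.exists
      exact ⟨n, fun i => (hx i).1, fun i => (hn i).le⟩
  have ht : ∀ (ρ : Measure (ι → ℝ)) [IsProbabilityMeasure ρ],
      Tendsto (fun n => ρ.real (Set.Icc a (c n))) atTop
        (𝓝 (ρ.real (Set.univ.pi fun i => Set.Ico (a i) (b i)))) := by
    intro ρ _
    rw [← hU]
    exact (ENNReal.tendsto_toReal (measure_ne_top _ _)).comp (tendsto_measure_iUnion_atTop hmono)
  refine le_of_tendsto ((ht μ).sub (ht ν)).abs (Eventually.of_forall fun n => ?_)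
  refine abs_measureReal_sub_le_extremeNorm μ ν ⟨a, c n, fun i => ?_, rfl⟩
  obtain ⟨h0, h1, h2⟩ := hab i
  have h3 : (1 / 2 : ℝ) ^ (n + 1) < 1 := pow_lt_one₀ (by norm_num) (by norm_num) (by omega)
  have h4 : 0 < (b i - a i) * (1 / 2 : ℝ) ^ (n + 1) := mul_pos (sub_pos.2 h1) (by positivity)
  have h5 := mul_lt_mul_of_pos_left h3 (sub_pos.2 h1)
  refine ⟨h0, ?_, ?_⟩ <;> simp only [hc] <;> linarith

/-- On unions of grid cells, the difference of two measures on the unit cube is bounded by the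
number of cells times the extreme norm. -/
theorem abs_measureReal_index_preimage_sub_le [Fintype ι] (d m : ℕ)
    (hμ : μ (unitCube ι)ᶜ = 0) (hν : ν (unitCube ι)ᶜ = 0) (T : Set (ι → ℕ)) :
    |μ.real {y | (fun i => HilbertOrder.index d m (y i)) ∈ T} -
      ν.real {y | (fun i => HilbertOrder.index d m (y i)) ∈ T}| ≤
      ((2 : ℝ) ^ (d * m)) ^ Fintype.card ι * extremeNorm μ ν := by
  classical
  let s : Finset (ι → Fin (2 ^ (d * m))) := {n | (fun i => (n i : ℕ)) ∈ T}
  let A : (ι → Fin (2 ^ (d * m))) → Set (ι → ℝ) := fun n => Set.univ.pi fun i =>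
    Set.Ico (((n i : ℕ) : ℝ) / 2 ^ (d * m)) (((n i : ℕ) + 1 : ℝ) / 2 ^ (d * m))
  have hp : (0 : ℝ) < 2 ^ (d * m) := by positivity
  have key : ∀ (ρ : Measure (ι → ℝ)) [IsProbabilityMeasure ρ], ρ (unitCube ι)ᶜ = 0 →
      ρ.real {y | (fun i => HilbertOrder.index d m (y i)) ∈ T} = ∑ n ∈ s, ρ.real (A n) := by
    intro ρ _ hρ
    have hmem : ∀ y ∈ unitCube ι, ∀ n : ι → Fin (2 ^ (d * m)),
        y ∈ A n ↔ ∀ i, HilbertOrder.index d m (y i) = n i := by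
      intro y hy n
      simp only [A, Set.mem_pi, Set.mem_univ, true_imp_iff]
      exact forall_congr' fun i => (HilbertOrder.index_eq_iff (hy i).1 (hy i).2).symm
    have hdisj : Set.PairwiseDisjoint (s : Set (ι → Fin (2 ^ (d * m)))) A := by
      intro n _ n' _ hne
      refine Set.disjoint_left.2 fun y hy hy' => hne ?_
      have hy1 : y ∈ unitCube ι := fun i => by
        have h1 := hy i (Set.mem_univ i)
        refine ⟨h1.1.trans' (by positivity), h1.2.trans_le ?_⟩
        rw [div_le_one hp]
        exact_mod_cast (n i).2
      funext i
      exact Fin.ext (((hmem y hy1 n).1 hy i).symm.trans ((hmem y hy1 n').1 hy' i))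
    have hA : ∀ n ∈ s, MeasurableSet (A n) := fun n _ =>
      MeasurableSet.univ_pi fun i => measurableSet_Ico
    rw [← measureReal_biUnion_finset hdisj hA]
    -- `index` clamps times outside `[0,1)` to the extreme cells, so the two sets agree only almost
    -- everywhere.
    refine measureReal_congr ?_
    have hae : ∀ᵐ y ∂ρ, y ∈ unitCube ι := hρ
    filter_upwards [hae] with y hy
    refine propext ?_
    change _ ∈ T ↔ y ∈ ⋃ n ∈ s, A n
    simp only [Set.mem_iUnion, exists_prop, hmem y hy, s, Finset.mem_filter, Finset.mem_univ,
      true_and]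
    constructor
    · exact fun h => ⟨fun i => ⟨_, HilbertOrder.index_lt d m (y i)⟩, h, fun i => rfl⟩
    · rintro ⟨n, hn, hi⟩
      rwa [funext hi]
  rw [key μ hμ, key ν hν, ← Finset.sum_sub_distrib]
  calc |∑ n ∈ s, (μ.real (A n) - ν.real (A n))|
      ≤ ∑ n ∈ s, |μ.real (A n) - ν.real (A n)| := Finset.abs_sum_le_sum_abs _ _
    _ ≤ ∑ n ∈ s, extremeNorm μ ν := by
        refine Finset.sum_le_sum fun n _ => abs_measureReal_pi_Ico_sub_le_extremeNorm μ ν ?_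
        intro i
        refine ⟨by positivity, ?_, ?_⟩
        · rw [div_lt_div_iff_of_pos_right hp]
          linarith
        · rw [div_le_one hp]
          exact_mod_cast (n i).2
    _ ≤ ∑ n, extremeNorm μ ν := by
        exact Finset.sum_le_sum_of_subset_of_nonneg (Finset.subset_univ _) fun _ _ _ =>
          extremeNorm_nonneg μ ν
    _ = _ := by simp

end ExtremeNorm

/-! ### Slabs and null sets in the unit cube -/

/-- The part of the unit cube between two hyperplanes at distance `2δ` has volume at most `2δ`. -/
theorem volume_restrict_unitCube_slab_le {ι : Type*} [Fintype ι] (p : ι) (a δ : ℝ) :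
    (volume.restrict (unitCube ι)) {x : ι → ℝ | |x p - a| ≤ δ} ≤ ENNReal.ofReal (2 * δ) := by
  classical
  have hm : MeasurableSet {x : ι → ℝ | |x p - a| ≤ δ} :=
    measurableSet_le (by fun_prop) measurable_const
  rw [Measure.restrict_apply hm]
  let S : ι → Set ℝ := Function.update (fun _ => Set.Ico 0 1) p (Set.Icc (a - δ) (a + δ))
  calc volume ({x : ι → ℝ | |x p - a| ≤ δ} ∩ unitCube ι)
      ≤ volume (Set.univ.pi S) := by
        refine measure_mono fun x hx i _ => ?_
        by_cases hi : i = p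
        · subst hi
          have := abs_le.1 (show |x i - a| ≤ δ from hx.1)
          simp only [S, Function.update_self]
          constructor <;> linarith
        · simp only [S, Function.update_of_ne hi]
          exact hx.2 i
    _ = ∏ i, volume (S i) := volume_pi_pi S
    _ = ENNReal.ofReal (2 * δ) := by
        rw [Finset.prod_eq_single p]
        · simp only [S, Function.update_self, Real.volume_Icc]
          congr 1
          ring
        · intro i _ hi
          simp [S, Function.update_of_ne hi]
        · simp

theorem volume_eval_mem_countable {ι : Type*} [Fintype ι] {Q : Set ℝ} (hQ : Q.Countable) :
    ∀ᵐ x : ι → ℝ, ∀ i, x i ∉ Q := by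
  refine ae_all_iff.2 fun i => ?_
  have := Measure.pi_eval_preimage_null (fun _ : ι => (volume : Measure ℝ)) (i := i)
    (s := Q) (hQ.measure_zero _)
  exact measure_eq_zero_iff_ae_notMem.1 this

theorem measurable_prodCurve {d : ℕ} (O : HilbertOrder d) (k : ℕ) :
    Measurable (prodCurve k O.curve) :=
  measurable_pi_lambda _ fun p =>
    (measurable_pi_apply p.2).comp (O.measurable_curve.comp (measurable_pi_apply p.1))

theorem measurableSet_index_preimage {ι : Type*} [Finite ι] (d m : ℕ) (T : Set (ι → ℕ)) :
    MeasurableSet {y : ι → ℝ | (fun i => HilbertOrder.index d m (y i)) ∈ T} :=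
  (measurable_pi_lambda (fun (y : ι → ℝ) i => HilbertOrder.index d m (y i)) fun i =>
    (HilbertOrder.measurable_index d m).comp (measurable_pi_apply i)) (MeasurableSet.of_discrete (s := T))

/-! ### The pseudo-inverse and the comparison on a box -/

section PseudoInverse

variable {d k : ℕ} {O : HilbertOrder d} {h : (Fin d → ℝ) → ℝ}
  {π : Measure (Fin (k + 1) × Fin d → ℝ)}

/-- A block sent to `1` must equal `O.curve 1`, which is a null event since `d ≥ 1`. -/
theorem ae_pseudoInverse_mem (hd : 1 ≤ d) (hh : IsPseudoInverse O.curve h)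
    (hac : π ≪ volume.restrict (unitCube (Fin (k + 1) × Fin d))) :
    ∀ᵐ x ∂π, ∀ i, 0 ≤ h (fun j => x (i, j)) ∧ h (fun j => x (i, j)) < 1 ∧
      O.curve (h (fun j => x (i, j))) = fun j => x (i, j) := by
  have hcube : ∀ᵐ x ∂π, x ∈ unitCube (Fin (k + 1) × Fin d) :=
    hac.ae_le (ae_restrict_mem (measurableSet_unitCube _))
  have hend := hac.ae_le (ae_restrict_of_ae (volume_eval_mem_countable
    (ι := Fin (k + 1) × Fin d) (Set.countable_range (O.curve 1))))
  filter_upwards [hcube, hend] with x hx hx1 i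
  obtain ⟨h1, h2⟩ := hh (fun j => x (i, j)) ⟨fun j => (hx _).1, fun j => (hx _).2.le⟩
  refine ⟨h1.1, lt_of_le_of_ne h1.2 fun h3 => ?_, h2⟩
  refine hx1 (i, ⟨0, hd⟩) ⟨⟨0, hd⟩, ?_⟩
  rw [← h3, h2]

/-- `Measure.map` is zero for maps that are not a.e. measurable, so this makes `π.map` the genuine
image measure. -/
theorem aemeasurable_prodPseudoInverse (hd : 1 ≤ d) (hh : IsPseudoInverse O.curve h)
    (hac : π ≪ volume.restrict (unitCube (Fin (k + 1) × Fin d))) :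
    AEMeasurable (prodPseudoInverse k h) π := by
  refine aemeasurable_pi_lambda _ fun i => ?_
  refine O.aemeasurable_pseudoInverse_comp hd (g := fun x : Fin (k + 1) × Fin d → ℝ =>
    fun j => x (i, j)) (measurable_pi_lambda _ fun j => measurable_pi_apply _)
    ((ae_pseudoInverse_mem hd hh hac).mono fun x hx => hx i) ?_
  have hdy := hac.ae_le (ae_restrict_of_ae (volume_eval_mem_countable (ι := Fin (k + 1) × Fin d)
    (Set.countable_range fun q : ℕ × ℕ => (q.2 : ℝ) / 2 ^ q.1)))
  filter_upwards [hdy] with x hx j m n hmn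
  refine hx (i, j) ⟨(m, n), ?_⟩
  simp only
  rw [← hmn, mul_div_cancel_left₀ _ (by positivity)]

/-- The error made on a box is controlled by the extreme norm on the time side, and by the mass
of the dyadic neighbourhood of the faces of the box. -/
theorem abs_map_prodCurve_sub_le (hd : 1 ≤ d) (hh : IsPseudoInverse O.curve h)
    [IsProbabilityMeasure π]
    (hac : π ≪ volume.restrict (unitCube (Fin (k + 1) × Fin d)))
    (μ : Measure (Fin (k + 1) → ℝ)) [IsProbabilityMeasure μ]
    (hμ : μ (unitCube (Fin (k + 1)))ᶜ = 0) (m : ℕ) (a b : Fin (k + 1) × Fin d → ℝ) :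
    |(μ.map (prodCurve k O.curve)).real (Set.Icc a b) - π.real (Set.Icc a b)| ≤
      ((2 : ℝ) ^ (d * m)) ^ (k + 1) * extremeNorm μ (π.map (prodPseudoInverse k h)) +
      ∑ p, (π.real {x | |x p - a p| ≤ (1 / 2) ^ m} + π.real {x | |x p - b p| ≤ (1 / 2) ^ m}) := by
  have hae := ae_pseudoInverse_mem hd hh hac
  have hmeas := aemeasurable_prodPseudoInverse hd hh hac
  set ν := π.map (prodPseudoInverse k h) with hνdef
  have : IsProbabilityMeasure ν := Measure.isProbabilityMeasure_map hmeas
  have hν : ν (unitCube (Fin (k + 1)))ᶜ = 0 := by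
    rw [hνdef, Measure.map_apply_of_aemeasurable hmeas (measurableSet_unitCube _).compl]
    refine measure_eq_zero_iff_ae_notMem.2 (hae.mono fun x hx => ?_)
    exact fun hc => hc fun i => ⟨(hx i).1, (hx i).2.1⟩
  let c : (Fin (k + 1) → ℕ) → Fin (k + 1) × Fin d → ℝ := fun n p => O.cell m (n p.1) p.2
  let I : (Fin (k + 1) → ℝ) → Fin (k + 1) → ℕ := fun y i => HilbertOrder.index d m (y i)
  let outer : Set (Fin (k + 1) → ℕ) := {n | ∀ p, 2 ^ m * a p ≤ c n p + 1 ∧ c n p ≤ 2 ^ m * b p}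
  let inner : Set (Fin (k + 1) → ℕ) := {n | ∀ p, 2 ^ m * a p ≤ c n p ∧ c n p + 1 ≤ 2 ^ m * b p}
  have h2 : (0 : ℝ) < 2 ^ m := by positivity
  have hc : ∀ y p, c (I y) p ≤ 2 ^ m * prodCurve k O.curve y p ∧
      2 ^ m * prodCurve k O.curve y p ≤ c (I y) p + 1 := fun y p =>
    ⟨O.cell_le_curve m (y p.1) p.2, O.curve_le_cell_add_one m (y p.1) p.2⟩
  have hin : ∀ y, I y ∈ inner → prodCurve k O.curve y ∈ Set.Icc a b := by
    intro y hy
    constructor <;> intro p <;> refine le_of_mul_le_mul_left ?_ h2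
    · exact (hy p).1.trans (hc y p).1
    · exact (hc y p).2.trans (hy p).2
  have hout : ∀ y, prodCurve k O.curve y ∈ Set.Icc a b → I y ∈ outer := by
    intro y hy p
    have h3 := mul_le_mul_of_nonneg_left (hy.1 p) h2.le
    have h4 := mul_le_mul_of_nonneg_left (hy.2 p) h2.le
    exact ⟨h3.trans (hc y p).2, (hc y p).1.trans h4⟩
  have hcurve : ∀ᵐ x ∂π, prodCurve k O.curve (prodPseudoInverse k h x) = x :=
    hae.mono fun x hx => funext fun p => congrFun (hx p.1).2.2 p.2
  have hνT : ∀ T : Set (Fin (k + 1) → ℕ),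
      ν.real {y | I y ∈ T} = π.real {x | I (prodPseudoInverse k h x) ∈ T} := fun T => by
    rw [hνdef, map_measureReal_apply_of_aemeasurable hmeas (measurableSet_index_preimage d m T)]
    rfl
  have hμB : (μ.map (prodCurve k O.curve)).real (Set.Icc a b) =
      μ.real (prodCurve k O.curve ⁻¹' Set.Icc a b) :=
    map_measureReal_apply (measurable_prodCurve O k) measurableSet_Icc
  have e1 : μ.real {y | I y ∈ inner} ≤ μ.real (prodCurve k O.curve ⁻¹' Set.Icc a b) :=
    measureReal_mono fun y hy => hin y hy
  have e2 : μ.real (prodCurve k O.curve ⁻¹' Set.Icc a b) ≤ μ.real {y | I y ∈ outer} :=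
    measureReal_mono fun y hy => hout y hy
  have e3 : ν.real {y | I y ∈ inner} ≤ π.real (Set.Icc a b) := by
    rw [hνT]
    refine ENNReal.toReal_mono (measure_ne_top _ _) (measure_mono_ae ?_)
    filter_upwards [hcurve] with x hx hI
    have := hin _ hI
    rwa [hx] at this
  have e4 : π.real (Set.Icc a b) ≤ ν.real {y | I y ∈ outer} := by
    rw [hνT]
    refine ENNReal.toReal_mono (measure_ne_top _ _) (measure_mono_ae ?_)
    filter_upwards [hcurve] with x hx hB
    exact hout _ (by rwa [hx])
  have e5 : ν.real {y | I y ∈ outer} ≤ ν.real {y | I y ∈ inner} +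
      ∑ p, (π.real {x | |x p - a p| ≤ (1 / 2) ^ m} + π.real {x | |x p - b p| ≤ (1 / 2) ^ m}) := by
    rw [hνT, hνT]
    have hsub : π.real {x | I (prodPseudoInverse k h x) ∈ outer} ≤
        π.real ({x | I (prodPseudoInverse k h x) ∈ inner} ∪
          ⋃ p, ({x | |x p - a p| ≤ (1 / 2) ^ m} ∪ {x | |x p - b p| ≤ (1 / 2) ^ m})) := by
      refine ENNReal.toReal_mono (measure_ne_top _ _) (measure_mono_ae ?_)
      filter_upwards [hcurve] with x hx hI
      by_cases hI' : I (prodPseudoInverse k h x) ∈ inner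
      · exact Or.inl hI'
      · refine Or.inr ?_
        -- A cube in `outer` but not in `inner` straddles or touches a face hyperplane in some
        -- coordinate `p`; `x` is in that cube, hence within `2^(-m)` of the hyperplane.
        obtain ⟨p, hp⟩ := not_forall.1 hI'
        refine Set.mem_iUnion.2 ⟨p, ?_⟩
        obtain ⟨h3, h4⟩ := hI p
        obtain ⟨h5, h6⟩ := hc (prodPseudoInverse k h x) p
        rw [hx] at h5 h6
        have hslab : ∀ z : ℝ, |2 ^ m * x p - 2 ^ m * z| ≤ 1 → |x p - z| ≤ (1 / 2) ^ m := by
          intro z hz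
          rw [← mul_sub, abs_mul, abs_of_pos h2] at hz
          rw [one_div, inv_pow, ← one_div]
          rwa [le_div_iff₀' h2]
        rcases not_and_or.1 hp with hp | hp <;> rw [not_le] at hp
        · refine Or.inl (hslab _ ?_)
          rw [abs_le]
          constructor <;> linarith
        · refine Or.inr (hslab _ ?_)
          rw [abs_le]
          constructor <;> linarith
    refine hsub.trans ((measureReal_union_le _ _).trans (add_le_add_right ?_ _))
    exact (measureReal_iUnion_fintype_le _).trans
      (Finset.sum_le_sum fun p _ => measureReal_union_le _ _)
  have e6 := abs_measureReal_index_preimage_sub_le μ ν d m hμ hν inner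
  have e7 := abs_measureReal_index_preimage_sub_le μ ν d m hμ hν outer
  rw [Fintype.card_fin, abs_le] at e6 e7
  rw [hμB, abs_le]
  constructor <;> linarith [e6.1, e6.2, e7.1, e7.2]

end PseudoInverse

/-! ### Bounded density and the limit -/

theorem withDensity_real_slab_le {ι : Type*} [Fintype ι] {F : (ι → ℝ) → ℝ≥0} {C : ℝ≥0}
    (hC : ∀ x, F x ≤ C) (p : ι) (a : ℝ) {δ : ℝ} (hδ : 0 ≤ δ) :
    ((volume.restrict (unitCube ι)).withDensity fun x => (F x : ℝ≥0∞)).real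
      {x : ι → ℝ | |x p - a| ≤ δ} ≤ C * (2 * δ) := by
  have hm : MeasurableSet {x : ι → ℝ | |x p - a| ≤ δ} :=
    measurableSet_le (by fun_prop) measurable_const
  refine ENNReal.toReal_le_of_le_ofReal (by positivity) ?_
  rw [withDensity_apply _ hm]
  calc ∫⁻ x in {x : ι → ℝ | |x p - a| ≤ δ}, (F x : ℝ≥0∞) ∂(volume.restrict (unitCube ι))
      ≤ ∫⁻ x in {x : ι → ℝ | |x p - a| ≤ δ}, (C : ℝ≥0∞) ∂(volume.restrict (unitCube ι)) :=
        lintegral_mono fun x => ENNReal.coe_le_coe.2 (hC x)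
    _ = C * (volume.restrict (unitCube ι)) {x : ι → ℝ | |x p - a| ≤ δ} := setLIntegral_const _ _
    _ ≤ C * ENNReal.ofReal (2 * δ) := by gcongr; exact volume_restrict_unitCube_slab_le p a δ
    _ = ENNReal.ofReal (C * (2 * δ)) := by
        rw [ENNReal.ofReal_mul (NNReal.coe_nonneg C), ENNReal.ofReal_coe_nnreal]

theorem mainTheorem4 (d : ℕ) (hd : 1 ≤ d) (k : ℕ)
    -- the Hilbert curve `O.curve` and a pseudo-inverse `h`
    (O : HilbertOrder d) (h : (Fin d → ℝ) → ℝ) (hh : IsPseudoInverse O.curve h)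
    -- the probability measure `π` on `[0,1)^(d(k+1))` with bounded density `f`
    (π : Measure (Fin (k + 1) × Fin d → ℝ)) (hπ : IsProbabilityMeasure π)
    (f : (Fin (k + 1) × Fin d → ℝ) → ℝ≥0) (hf : Measurable f)
    (hbdd : ∃ C : ℝ≥0, ∀ x, f x ≤ C)
    (hdens : π = (volume.restrict (unitCube (Fin (k + 1) × Fin d))).withDensity
      (fun x => (f x : ℝ≥0∞)))
    -- the probability measures `π_{h_k}^N` on `[0,1)^(k+1)`
    (πhN : ℕ → Measure (Fin (k + 1) → ℝ)) (hprob : ∀ N, IsProbabilityMeasure (πhN N))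
    (hsupp : ∀ N, πhN N (unitCube (Fin (k + 1)))ᶜ = 0)
    (hconv : Tendsto (fun N => extremeNorm (πhN N) (π.map (prodPseudoInverse k h)))
      atTop (𝓝 0)) :
    Tendsto (fun N => extremeNorm ((πhN N).map (prodCurve k O.curve)) π) atTop (𝓝 0) := by
  obtain ⟨C, hC⟩ := hbdd
  have hac : π ≪ volume.restrict (unitCube (Fin (k + 1) × Fin d)) :=
    hdens ▸ withDensity_absolutelyContinuous _ _
  have hnonneg : ∀ N, 0 ≤ extremeNorm (πhN N) (π.map (prodPseudoInverse k h)) := fun N =>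
    extremeNorm_nonneg _ _
  -- There are `(k + 1) * d` coordinates with two faces each, and each slab has width `2 * (1 / 2) ^
  -- m`.
  have hbound : ∀ m N, extremeNorm ((πhN N).map (prodCurve k O.curve)) π ≤
      ((2 : ℝ) ^ (d * m)) ^ (k + 1) * extremeNorm (πhN N) (π.map (prodPseudoInverse k h)) +
      (((k + 1) * d : ℕ) * (4 * C)) * (1 / 2) ^ m := by
    intro m N
    refine Real.sSup_le ?_ (add_nonneg (mul_nonneg (by positivity) (hnonneg N)) (by positivity))
    rintro _ ⟨_, ⟨a, b, -, rfl⟩, rfl⟩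
    refine (abs_map_prodCurve_sub_le hd hh hac (πhN N) (hsupp N) m a b).trans
      (add_le_add_right ?_ _)
    have hs : ∀ p z, π.real {x | |x p - z| ≤ (1 / 2) ^ m} ≤ C * (2 * (1 / 2) ^ m) := fun p z => by
      rw [hdens]
      exact withDensity_real_slab_le hC p z (by positivity)
    refine (Finset.sum_le_card_nsmul Finset.univ _ ((C : ℝ) * (4 * (1 / 2) ^ m))
      fun p _ => ?_).trans_eq ?_
    · linarith [hs p (a p), hs p (b p)]
    · rw [Finset.card_univ, Fintype.card_prod, Fintype.card_fin, Fintype.card_fin, nsmul_eq_mul]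
      ring
  have hsmall : Tendsto (fun m : ℕ => (((k + 1) * d : ℕ) * (4 * C) : ℝ) * (1 / 2) ^ m) atTop
      (𝓝 0) := by
    simpa using (tendsto_pow_atTop_nhds_zero_of_lt_one (r := (1 / 2 : ℝ)) (by norm_num)
      (by norm_num)).const_mul (((k + 1) * d : ℕ) * (4 * C) : ℝ)
  refine tendsto_order.2 ⟨fun ε hε => Eventually.of_forall fun N =>
    hε.trans_le (extremeNorm_nonneg _ _), fun ε hε => ?_⟩
  -- The level is fixed before `N`, since the factor of the extreme norm grows with `m`.
  obtain ⟨m, hm⟩ := (hsmall.eventually_lt_const (half_pos hε)).exists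
  have ht : Tendsto (fun N => ((2 : ℝ) ^ (d * m)) ^ (k + 1) *
      extremeNorm (πhN N) (π.map (prodPseudoInverse k h))) atTop (𝓝 0) := by
    simpa using hconv.const_mul (((2 : ℝ) ^ (d * m)) ^ (k + 1))
  filter_upwards [ht.eventually_lt_const (half_pos hε)] with N hN
  linarith [hbound m N]
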